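/- Let $\mathcal M_d$ denote the algebra of complex $d\times d$ matrices. For $A\in\mathcal M_d$ and real $p\ge 1$ let $\|A\|_p=(\operatorname{Tr}|A|^p)^{1/p}$, $|A|=(AA^*)^{1/2}$, be the Schatten norm, and for a linear map $L:\mathcal M_d\to\mathcal M_{d'}$ and real $q,p\ge 1$ let $\|L\|_{q\to p}=\sup_{0\ne A\in\mathcal M_d}\|L(A)\|_p/\|A\|_q$. The map $L$ is completely positive if $\mathrm{id}_n\otimes L$ maps positive semidefinite matrices to positive semidefinite matrices for every $n\ge 1$. For a completely positive map $\Phi$ on $\mathcal M_d$, the potential output purity is $$\|\Phi\|^{(\mathrm{pot})}_{q\to p}=\sup_{n\ge 1}\ \sup_{\Omega}\ \frac{\|\Phi\otimes\Omega\|_{q\to p}}{\|\Omega\|_{q\to p}},$$ where $\Omega$ runs over all nonzero completely positive maps on $\mathcal M_n$. Let $\{|i\rangle\}_{i=1}^d$ be an orthonormal basis of $\mathbb C^d$, let $C=\sum_{i,j}c_{ij}|i\rangle\langle j|\in\mathcal M_d$ be positive semidefinite, and let $H_C:\mathcal M_d\to\mathcal M_d$ be the Hadamard map $H_C\big(\sum_{i,j}a_{ij}|i\rangle\langle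 j|\big)=\sum_{i,j}c_{ij}a_{ij}|i\rangle\langle j|$. Theorem. For all real $q,p$ with $1\le q\le 2\le p$, $$\|H_C\|^{(\mathrm{pot})}_{q\to p}=\|H_C\|_{q\to p}.$$ -/

import Mathlib

open scoped Kronecker ENNReal ComplexOrder

namespace OutputPurity

/-- The absolute value `|A| = (A A^*)^{1/2}` of a complex square matrix. -/
noncomputable def absMatrix {m : Type*} [Fintype m] [DecidableEq m] (A : Matrix m m ℂ) : Matrix m m ℂ :=
  cfc Real.sqrt (A * A.conjTranspose)

/-- The Schatten norm `‖A‖_p = (Tr |A|^p)^{1/p}`, for real `p ≥ 1`. -/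
noncomputable def schattenNorm {m : Type*} [Fintype m] [DecidableEq m] (p : ℝ) (A : Matrix m m ℂ) : ℝ :=
  (Matrix.trace (cfc (fun x : ℝ => x ^ p) (absMatrix A))).re ^ (1 / p)

/-- The norm `‖L‖_{q → p} = sup_{A ≠ 0} ‖L(A)‖_p / ‖A‖_q` of a linear map between matrix
algebras, the supremum being taken in `[0, ∞]`. -/
noncomputable def outputPurity {m n : Type*} [Fintype m] [DecidableEq m] [Fintype n] [DecidableEq n]
    (q p : ℝ) (L : Matrix m m ℂ →ₗ[ℂ] Matrix n n ℂ) : ℝ≥0∞ :=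
  ⨆ (A : Matrix m m ℂ) (_ : A ≠ 0), ENNReal.ofReal (schattenNorm p (L A) / schattenNorm q A)

/-- The block `A_{ij}` of `A = ∑_{i,j} |i⟩⟨j| ⊗ A_{ij}`. -/
def block {m n : Type*} (A : Matrix (m × n) (m × n) ℂ) (i j : m) : Matrix n n ℂ :=
  Matrix.of fun k l => A (i, k) (j, l)

/-- The tensor product `Φ ⊗ Ω` of two linear maps between matrix algebras, with `M_m ⊗ M_n`
identified with the matrices indexed by `m × n` through the Kronecker product:
`(Φ ⊗ Ω)(A) = ∑_{i,j} Φ(|i⟩⟨j|) ⊗ Ω(A_{ij})`. -/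
noncomputable def tensorMap {m m' n n' : Type*} [Fintype m] [DecidableEq m]
    (Φ : Matrix m m ℂ →ₗ[ℂ] Matrix m' m' ℂ) (Ω : Matrix n n ℂ →ₗ[ℂ] Matrix n' n' ℂ) :
    Matrix (m × n) (m × n) ℂ →ₗ[ℂ] Matrix (m' × n') (m' × n') ℂ where
  toFun A := ∑ i, ∑ j, Φ (Matrix.single i j 1) ⊗ₖ Ω (block A i j)
  map_add' A B := by
    have h : ∀ i j, block (A + B) i j = block A i j + block B i j := fun i j => rfl
    simp only [h, map_add, Matrix.kronecker_add, Finset.sum_add_distrib]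
  map_smul' c A := by
    have h : ∀ i j, block (c • A) i j = c • block A i j := fun i j => rfl
    simp only [h, map_smul, Matrix.kronecker_smul, Finset.smul_sum, RingHom.id_apply]

/-- The map `tensorMap Φ Ω` acts on product matrices as `A ⊗ B ↦ Φ(A) ⊗ Ω(B)`. -/
theorem tensorMap_kronecker {m m' n n' : Type*} [Fintype m] [DecidableEq m] (Φ : Matrix m m ℂ →ₗ[ℂ] Matrix m' m' ℂ)
    (Ω : Matrix n n ℂ →ₗ[ℂ] Matrix n' n' ℂ) (A : Matrix m m ℂ) (B : Matrix n n ℂ) :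
    tensorMap Φ Ω (A ⊗ₖ B) = Φ A ⊗ₖ Ω B := by
  have h : ∀ i j, block (A ⊗ₖ B) i j = A i j • B := fun i j => rfl
  have hA : Φ A = ∑ i, ∑ j, A i j • Φ (Matrix.single i j 1) := by
    conv_lhs => rw [Matrix.matrix_eq_sum_single A]
    simp only [map_sum, ← map_smul, Matrix.smul_single, smul_eq_mul, mul_one]
  have hsum : ∀ (s : Finset m) (f : m → Matrix m' m' ℂ),
      (∑ i ∈ s, f i) ⊗ₖ Ω B = ∑ i ∈ s, f i ⊗ₖ Ω B := fun s f => by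
    ext x y
    simp [Matrix.sum_apply, Finset.sum_mul]
  change ∑ i, ∑ j, Φ (Matrix.single i j 1) ⊗ₖ Ω (block (A ⊗ₖ B) i j) = _
  simp only [h, hA, hsum, map_smul, Matrix.kronecker_smul, Matrix.smul_kronecker]

/-- A linear map `L` is completely positive if `id_k ⊗ L` preserves positive semidefiniteness
for all `k ≥ 1`. -/
def IsCompletelyPositive {m n : Type*} [Fintype m] [Fintype n]
    (L : Matrix m m ℂ →ₗ[ℂ] Matrix n n ℂ) : Prop :=
  ∀ k : ℕ, 1 ≤ k → ∀ A : Matrix (Fin k × m) (Fin k × m) ℂ, A.PosSemidef →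
    (tensorMap (LinearMap.id : Matrix (Fin k) (Fin k) ℂ →ₗ[ℂ] _) L A).PosSemidef

/-- The potential output purity `‖Φ‖_{q → p}^{(pot)}`: the supremum, in `[0, ∞]`, of
`‖Φ ⊗ Ω‖_{q → p} / ‖Ω‖_{q → p}` over all `k ≥ 1` and all nonzero completely positive maps `Ω`
on the `k × k` matrices. -/
noncomputable def potentialPurity {m m' : Type*} [Fintype m] [DecidableEq m] [Fintype m']
    [DecidableEq m'] (q p : ℝ) (Φ : Matrix m m ℂ →ₗ[ℂ] Matrix m' m' ℂ) : ℝ≥0∞ :=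
  ⨆ (k : ℕ) (_ : 1 ≤ k) (Ω : Matrix (Fin k) (Fin k) ℂ →ₗ[ℂ] Matrix (Fin k) (Fin k) ℂ)
    (_ : IsCompletelyPositive Ω) (_ : Ω ≠ 0),
    outputPurity q p (tensorMap Φ Ω) / outputPurity q p Ω

/-- The matrix entry `⟨i| A |j⟩` of `A` in the orthonormal basis `b`. -/
noncomputable def entry {m : Type*} [Fintype m] (b : OrthonormalBasis m ℂ (EuclideanSpace ℂ m))
    (A : Matrix m m ℂ) (i j : m) : ℂ :=
  star (b i : m → ℂ) ⬝ᵥ (A.mulVec (b j : m → ℂ))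

/-- The Hadamard map `H_C` with respect to the orthonormal basis `b`:
`H_C(A) = ∑_{i,j} c_{ij} a_{ij} |i⟩⟨j|`, where `c_{ij}` and `a_{ij}` are the entries of `C` and `A`
in the basis `b` and `|i⟩ = b i`. -/
noncomputable def hadamardMap {m : Type*} [Fintype m] (b : OrthonormalBasis m ℂ (EuclideanSpace ℂ m))
    (C : Matrix m m ℂ) : Matrix m m ℂ →ₗ[ℂ] Matrix m m ℂ where
  toFun A := ∑ i, ∑ j,
    (entry b C i j * entry b A i j) • Matrix.vecMulVec (b i : m → ℂ) (star (b j : m → ℂ))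
  map_add' A B := by
    have h : ∀ i j, entry b (A + B) i j = entry b A i j + entry b B i j := fun i j => by
      simp [entry, Matrix.add_mulVec, dotProduct_add]
    simp only [h, mul_add, add_smul, Finset.sum_add_distrib]
  map_smul' c A := by
    have h : ∀ i j, entry b (c • A) i j = c * entry b A i j := fun i j => by
      simp [entry, Matrix.smul_mulVec, dotProduct_smul]
    simp only [h, Finset.smul_sum, smul_smul, RingHom.id_apply, mul_left_comm]

end OutputPurity

/-! Written blockwise in the basis `b`, `H_C ⊗ Ω` sends `A_{ij}` to `c_{ij} Ω(A_{ij})`. For `q ≤ 2 ≤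
p` the Schatten norms compare with their blocks in opposite directions: `‖M‖_p² ≤ ∑ ‖M_{ij}‖_p²` and
`∑ ‖M_{ij}‖_q² ≤ ‖M‖_q²`. Hence `‖H_C ⊗ Ω‖ ≤ max |c_{ij}| · ‖Ω‖`. Positivity of `C` puts this
maximum on the diagonal, and testing `H_C` on `|i⟩⟨i|` gives `|c_{ii}| ≤ ‖H_C‖`. The converse
inequality takes `Ω` to be the identity on `1 × 1` matrices.

The block inequalities rest on `‖M‖_p² = ‖M Mᴴ‖_{p/2}`. The matrix `M Mᴴ` is the sum of the Gram
matrices of the block columns of `M`, so Minkowski's inequality for positive matrices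
(`eigenPowerSum_sum_le`), or its reverse for exponents at most 1 (`sum_le_eigenPowerSum_sum`),
splits `M` into columns; after an adjoint the same step splits columns into blocks. -/

namespace OutputPurity

open Matrix Finset

/-! ### Eigenvalue power sums and Schatten norms -/

/-- The sum of the `r`-th powers of the (real parts of the) eigenvalues of a matrix. -/
noncomputable def eigenPowerSum {m : Type*} [Fintype m] [DecidableEq m] (r : ℝ)
    (X : Matrix m m ℂ) : ℝ :=
  (X.charpoly.roots.map fun z => z.re ^ r).sum

theorem eigenPowerSum_eq_sum_eigenvalues {m : Type*} [Fintype m] [DecidableEq m] (r : ℝ)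
    {X : Matrix m m ℂ} (hX : X.IsHermitian) :
    eigenPowerSum r X = ∑ i, hX.eigenvalues i ^ r := by
  rw [eigenPowerSum, hX.roots_charpoly_eq_eigenvalues, Multiset.map_map]
  rfl

/-- The characteristic polynomials of `AB` and `BA` agree up to powers of `X`, and the extra zero
roots contribute `0 ^ r = 0`. Working with roots allows rectangular factors. -/
theorem eigenPowerSum_mul_comm {m n : Type*} [Fintype m] [DecidableEq m] [Fintype n]
    [DecidableEq n] {r : ℝ} (hr : r ≠ 0) (A : Matrix m n ℂ) (B : Matrix n m ℂ) :
    eigenPowerSum r (A * B) = eigenPowerSum r (B * A) := by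
  have h := congrArg Polynomial.roots (Matrix.charpoly_mul_comm' A B)
  rw [Polynomial.roots_mul, Polynomial.roots_mul] at h
  · have h' := congrArg (fun s : Multiset ℂ => (s.map fun z => z.re ^ r).sum) h
    simpa [eigenPowerSum, Multiset.map_nsmul, Multiset.sum_nsmul, Real.zero_rpow hr] using h'
  · exact mul_ne_zero (pow_ne_zero _ Polynomial.X_ne_zero) (Matrix.charpoly_monic _).ne_zero
  · exact mul_ne_zero (pow_ne_zero _ Polynomial.X_ne_zero) (Matrix.charpoly_monic _).ne_zero

theorem eigenPowerSum_nonneg {m : Type*} [Fintype m] [DecidableEq m] (r : ℝ)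
    {X : Matrix m m ℂ} (hX : X.PosSemidef) : 0 ≤ eigenPowerSum r X := by
  rw [eigenPowerSum_eq_sum_eigenvalues r hX.1]
  exact sum_nonneg fun i _ => Real.rpow_nonneg (hX.eigenvalues_nonneg i) r

theorem trace_cfc_re {m : Type*} [Fintype m] [DecidableEq m] {X : Matrix m m ℂ}
    (hX : X.IsHermitian) (f : ℝ → ℝ) : (cfc f X).trace.re = ∑ i, f (hX.eigenvalues i) := by
  rw [hX.cfc_eq, Matrix.IsHermitian.cfc, Unitary.conjStarAlgAut_apply, Matrix.trace_mul_comm,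
    ← mul_assoc]
  simp [Matrix.trace]

theorem schattenNorm_eq {m : Type*} [Fintype m] [DecidableEq m] {p : ℝ} (hp : 0 < p)
    (A : Matrix m m ℂ) : schattenNorm p A = eigenPowerSum (p / 2) (A * Aᴴ) ^ (1 / p) := by
  have hA : (A * Aᴴ).PosSemidef := Matrix.posSemidef_self_mul_conjTranspose A
  have h := cfc_comp' (fun x : ℝ => x ^ p) Real.sqrt (A * Aᴴ)
    (by exact (Real.continuous_rpow_const hp.le).continuousOn)
    (by exact Real.continuous_sqrt.continuousOn) hA.1
  rw [schattenNorm, absMatrix, ← h, trace_cfc_re hA.1, eigenPowerSum_eq_sum_eigenvalues _ hA.1]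
  congr 1
  refine sum_congr rfl fun i _ => ?_
  rw [Real.sqrt_eq_rpow, ← Real.rpow_mul (hA.eigenvalues_nonneg i)]
  congr 1
  ring

/-! ### Peierls' inequalities -/

/-- The diagonal of a positive semidefinite matrix in any orthonormal basis is the image of its
eigenvalues under a doubly stochastic matrix. -/
theorem exists_doublyStochastic_diag {m : Type*} [Fintype m] [DecidableEq m] {X : Matrix m m ℂ}
    (hX : X.IsHermitian) (U : Matrix.unitaryGroup m ℂ) :
    ∃ w : m → m → ℝ, (∀ i j, 0 ≤ w i j) ∧ (∀ i, ∑ j, w i j = 1) ∧ (∀ j, ∑ i, w i j = 1) ∧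
      ∀ i, (star (U : Matrix m m ℂ) * X * (U : Matrix m m ℂ)) i i
        = ((∑ j, w i j * hX.eigenvalues j : ℝ) : ℂ) := by
  -- `W` is the change of basis between the columns of `U` and an eigenbasis of `X`; the weights are
  -- `|W i j|²`.
  set W : Matrix.unitaryGroup m ℂ := star U * hX.eigenvectorUnitary with hW
  have h1 : (W : Matrix m m ℂ) * star (W : Matrix m m ℂ) = 1 := Unitary.coe_mul_star_self W
  have h2 : star (W : Matrix m m ℂ) * (W : Matrix m m ℂ) = 1 := Unitary.coe_star_mul_self W
  have hX' : star (U : Matrix m m ℂ) * X * (U : Matrix m m ℂ)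
      = (W : Matrix m m ℂ) * diagonal (RCLike.ofReal ∘ hX.eigenvalues) * star (W : Matrix m m ℂ) := by
    conv_lhs => rw [hX.spectral_theorem, Unitary.conjStarAlgAut_apply]
    simp [hW, mul_assoc]
  refine ⟨fun i j => Complex.normSq ((W : Matrix m m ℂ) i j), fun i j => Complex.normSq_nonneg _,
    fun i => ?_, fun j => ?_, fun i => ?_⟩
  · have := congrFun (congrFun h1 i) i
    rw [Matrix.mul_apply] at this
    simp only [Matrix.star_apply, RCLike.star_def, Complex.mul_conj, Matrix.one_apply_eq] at this
    exact_mod_cast this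
  · have := congrFun (congrFun h2 j) j
    rw [Matrix.mul_apply] at this
    simp only [Matrix.star_apply, RCLike.star_def, ← Complex.normSq_eq_conj_mul_self,
      Matrix.one_apply_eq] at this
    exact_mod_cast this
  · rw [hX', Matrix.mul_apply]
    push_cast
    refine sum_congr rfl fun j _ => ?_
    rw [Matrix.mul_diagonal, Matrix.star_apply, ← Complex.mul_conj]
    simp only [Function.comp_apply, RCLike.star_def, Complex.coe_algebraMap]
    ring_nf

/-- The `i`-th diagonal entry of `X` in the orthonormal basis given by the columns of `U`. -/
noncomputable def rotatedDiag {m : Type*} [Fintype m] [DecidableEq m] (U : Matrix.unitaryGroup m ℂ)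
    (X : Matrix m m ℂ) (i : m) : ℝ :=
  ((star (U : Matrix m m ℂ) * X * (U : Matrix m m ℂ)) i i).re

theorem rotatedDiag_nonneg {m : Type*} [Fintype m] [DecidableEq m] (U : Matrix.unitaryGroup m ℂ)
    {X : Matrix m m ℂ} (hX : X.PosSemidef) (i : m) : 0 ≤ rotatedDiag U X i := by
  obtain ⟨w, hw, -, -, h⟩ := exists_doublyStochastic_diag hX.1 U
  rw [rotatedDiag, h, Complex.ofReal_re]
  exact sum_nonneg fun j _ => mul_nonneg (hw i j) (hX.eigenvalues_nonneg j)

theorem rotatedDiag_sum {m ι : Type*} [Fintype m] [DecidableEq m] (U : Matrix.unitaryGroup m ℂ)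
    (s : Finset ι) (X : ι → Matrix m m ℂ) (i : m) :
    rotatedDiag U (∑ k ∈ s, X k) i = ∑ k ∈ s, rotatedDiag U (X k) i := by
  simp only [rotatedDiag, Finset.mul_sum, Finset.sum_mul, Matrix.sum_apply, Complex.re_sum]

theorem rotatedDiag_eigenvectorUnitary {m : Type*} [Fintype m] [DecidableEq m]
    {X : Matrix m m ℂ} (hX : X.IsHermitian) (i : m) :
    rotatedDiag hX.eigenvectorUnitary X i = hX.eigenvalues i := by
  have h := hX.conjStarAlgAut_star_eigenvectorUnitary
  rw [Unitary.conjStarAlgAut_star_apply] at h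
  rw [rotatedDiag, h]
  simp

/-- Peierls' inequality for convex powers. -/
theorem sum_rotatedDiag_rpow_le {m : Type*} [Fintype m] [DecidableEq m] {r : ℝ} (hr : 1 ≤ r)
    {X : Matrix m m ℂ} (hX : X.PosSemidef) (U : Matrix.unitaryGroup m ℂ) :
    ∑ i, rotatedDiag U X i ^ r ≤ eigenPowerSum r X := by
  obtain ⟨w, hw, h1, h2, h⟩ := exists_doublyStochastic_diag hX.1 U
  calc ∑ i, rotatedDiag U X i ^ r
      ≤ ∑ i, ∑ j, w i j * hX.1.eigenvalues j ^ r := by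
        refine sum_le_sum fun i _ => ?_
        rw [rotatedDiag, h, Complex.ofReal_re]
        exact (convexOn_rpow hr).map_sum_le (t := univ) (fun j _ => hw i j) (h1 i)
          (fun j _ => hX.eigenvalues_nonneg j)
    _ = eigenPowerSum r X := by
        rw [sum_comm, eigenPowerSum_eq_sum_eigenvalues r hX.1]
        exact sum_congr rfl fun j _ => by rw [← sum_mul, h2, one_mul]

/-- Peierls' inequality for concave powers. -/
theorem le_sum_rotatedDiag_rpow {m : Type*} [Fintype m] [DecidableEq m] {r : ℝ} (hr0 : 0 ≤ r)
    (hr : r ≤ 1) {X : Matrix m m ℂ} (hX : X.PosSemidef) (U : Matrix.unitaryGroup m ℂ) :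
    eigenPowerSum r X ≤ ∑ i, rotatedDiag U X i ^ r := by
  obtain ⟨w, hw, h1, h2, h⟩ := exists_doublyStochastic_diag hX.1 U
  calc eigenPowerSum r X = ∑ i, ∑ j, w i j * hX.1.eigenvalues j ^ r := by
        rw [sum_comm, eigenPowerSum_eq_sum_eigenvalues r hX.1]
        exact sum_congr rfl fun j _ => by rw [← sum_mul, h2, one_mul]
    _ ≤ ∑ i, rotatedDiag U X i ^ r := by
        refine sum_le_sum fun i _ => ?_
        rw [rotatedDiag, h, Complex.ofReal_re]
        exact (Real.concaveOn_rpow hr0 hr).le_map_sum (t := univ) (fun j _ => hw i j) (h1 i)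
          (fun j _ => hX.eigenvalues_nonneg j)

/-! ### Minkowski's inequality and its reverse for positive semidefinite matrices -/

/-- Minkowski's inequality for a finite sum of nonnegative vectors. -/
theorem Lp_sum_le_of_nonneg {ι κ : Type*} [Fintype κ] {s : ℝ} (hs : 1 ≤ s) (t : Finset ι)
    (a : ι → κ → ℝ) (ha : ∀ i k, 0 ≤ a i k) :
    (∑ k, (∑ i ∈ t, a i k) ^ s) ^ (1 / s) ≤ ∑ i ∈ t, (∑ k, a i k ^ s) ^ (1 / s) := by
  classical
  have hs0 : s ≠ 0 := by linarith
  induction t using Finset.induction_on with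
  | empty => simp [Real.zero_rpow hs0, Real.zero_rpow (inv_ne_zero hs0)]
  | insert i t hi ih =>
    simp only [sum_insert hi]
    exact (Real.Lp_add_le_of_nonneg univ hs (fun k _ => ha i k)
      (fun k _ => sum_nonneg fun j _ => ha j k)).trans (add_le_add le_rfl ih)

/-- In an eigenbasis of the sum, diagonals add up to its eigenvalues. Scalar Minkowski applies to
these diagonals, and Peierls bounds each by the spectrum of its summand. -/
theorem eigenPowerSum_sum_le {m ι : Type*} [Fintype m] [DecidableEq m] [Fintype ι] {r : ℝ}
    (hr : 1 ≤ r) (X : ι → Matrix m m ℂ) (hX : ∀ k, (X k).PosSemidef) :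
    eigenPowerSum r (∑ k, X k) ^ (1 / r) ≤ ∑ k, eigenPowerSum r (X k) ^ (1 / r) := by
  have hS : (∑ k, X k).PosSemidef := Matrix.posSemidef_sum _ fun k _ => hX k
  rw [eigenPowerSum_eq_sum_eigenvalues r hS.1]
  simp only [← rotatedDiag_eigenvectorUnitary hS.1, rotatedDiag_sum]
  refine (Lp_sum_le_of_nonneg hr univ _ fun k i => rotatedDiag_nonneg _ (hX k) i).trans ?_
  refine sum_le_sum fun k _ => Real.rpow_le_rpow ?_ (sum_rotatedDiag_rpow_le hr (hX k) _) ?_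
  · exact sum_nonneg fun i _ => Real.rpow_nonneg (rotatedDiag_nonneg _ (hX k) i) r
  · positivity

theorem sum_le_eigenPowerSum_sum {m ι : Type*} [Fintype m] [DecidableEq m] [Fintype ι] {r : ℝ}
    (hr0 : 0 < r) (hr : r ≤ 1) (X : ι → Matrix m m ℂ) (hX : ∀ k, (X k).PosSemidef) :
    ∑ k, eigenPowerSum r (X k) ^ (1 / r) ≤ eigenPowerSum r (∑ k, X k) ^ (1 / r) := by
  have hS : (∑ k, X k).PosSemidef := Matrix.posSemidef_sum _ fun k _ => hX k
  have hnn : ∀ (k : ι) (i : m), 0 ≤ rotatedDiag hS.1.eigenvectorUnitary (X k) i :=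
    fun k i => rotatedDiag_nonneg _ (hX k) i
  -- The reverse inequality is ordinary Minkowski with exponent `1 / r`, applied to the `r`-th
  -- powers with the roles of coordinate and summand exchanged.
  have key := Lp_sum_le_of_nonneg (s := 1 / r) (one_le_one_div hr0 hr) univ
    (fun i k => rotatedDiag hS.1.eigenvectorUnitary (X k) i ^ r)
    (fun i k => Real.rpow_nonneg (hnn k i) r)
  have hinv : ∀ x : ℝ, 0 ≤ x → (x ^ r) ^ (1 / r) = x := fun x hx => by
    rw [← Real.rpow_mul hx, mul_one_div_cancel hr0.ne', Real.rpow_one]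
  simp only [fun i k => hinv _ (hnn k i), one_div_one_div] at key
  have hR : eigenPowerSum r (∑ k, X k)
      = ∑ i, (∑ k, rotatedDiag hS.1.eigenvectorUnitary (X k) i) ^ r := by
    rw [eigenPowerSum_eq_sum_eigenvalues r hS.1]
    simp only [← rotatedDiag_eigenvectorUnitary hS.1, rotatedDiag_sum]
  have hL : 0 ≤ ∑ k, (∑ i, rotatedDiag hS.1.eigenvectorUnitary (X k) i ^ r) ^ (1 / r) :=
    sum_nonneg fun k _ => Real.rpow_nonneg
      (sum_nonneg fun i _ => Real.rpow_nonneg (hnn k i) r) _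
  calc ∑ k, eigenPowerSum r (X k) ^ (1 / r)
      ≤ ∑ k, (∑ i, rotatedDiag hS.1.eigenvectorUnitary (X k) i ^ r) ^ (1 / r) :=
        sum_le_sum fun k _ => Real.rpow_le_rpow (eigenPowerSum_nonneg r (hX k))
          (le_sum_rotatedDiag_rpow hr0.le hr (hX k) _) (by positivity)
    _ = ((∑ k, (∑ i, rotatedDiag hS.1.eigenvectorUnitary (X k) i ^ r) ^ (1 / r)) ^ r) ^ (1 / r) :=
        (hinv _ hL).symm
    _ ≤ _ := by
        rw [hR]
        exact Real.rpow_le_rpow (Real.rpow_nonneg hL r) key (by positivity)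

/-! ### Splitting a matrix into blocks -/

/-- The Schatten quasi-norm with exponent `r` of `M Mᴴ`, for a rectangular matrix `M`. -/
noncomputable def gramNorm {m n : Type*} [Fintype m] [DecidableEq m] [Fintype n] (r : ℝ)
    (M : Matrix m n ℂ) : ℝ :=
  eigenPowerSum r (M * Mᴴ) ^ (1 / r)

theorem gramNorm_conjTranspose {m n : Type*} [Fintype m] [DecidableEq m] [Fintype n]
    [DecidableEq n] {r : ℝ} (hr : r ≠ 0) (M : Matrix m n ℂ) : gramNorm r Mᴴ = gramNorm r M := by
  rw [gramNorm, gramNorm, conjTranspose_conjTranspose, eigenPowerSum_mul_comm hr]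

theorem mul_conjTranspose_eq_sum_blockColumns {a m n : Type*} [Fintype m] [Fintype n]
    (M : Matrix a (m × n) ℂ) :
    M * Mᴴ = ∑ j, M.submatrix id (Prod.mk j) * (M.submatrix id (Prod.mk j))ᴴ := by
  ext x y
  simp [Matrix.mul_apply, Matrix.sum_apply, Fintype.sum_prod_type]

theorem gramNorm_le_sum_blockColumns {a m n : Type*} [Fintype a] [DecidableEq a] [Fintype m]
    [Fintype n] {r : ℝ} (hr : 1 ≤ r) (M : Matrix a (m × n) ℂ) :
    gramNorm r M ≤ ∑ j, gramNorm r (M.submatrix id (Prod.mk j)) := by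
  rw [gramNorm, mul_conjTranspose_eq_sum_blockColumns]
  exact eigenPowerSum_sum_le hr _ fun j => posSemidef_self_mul_conjTranspose _

theorem sum_blockColumns_le_gramNorm {a m n : Type*} [Fintype a] [DecidableEq a] [Fintype m]
    [Fintype n] {r : ℝ} (hr0 : 0 < r) (hr : r ≤ 1) (M : Matrix a (m × n) ℂ) :
    ∑ j, gramNorm r (M.submatrix id (Prod.mk j)) ≤ gramNorm r M := by
  conv_rhs => rw [gramNorm, mul_conjTranspose_eq_sum_blockColumns]
  exact sum_le_eigenPowerSum_sum hr0 hr _ fun j => posSemidef_self_mul_conjTranspose _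

theorem gramNorm_block_eq {m n : Type*} [Fintype m] [DecidableEq m] [Fintype n] [DecidableEq n]
    {r : ℝ} (hr : r ≠ 0) (M : Matrix (m × n) (m × n) ℂ) (i j : m) :
    gramNorm r ((M.submatrix id (Prod.mk j))ᴴ.submatrix id (Prod.mk i))
      = gramNorm r (block M i j) := by
  rw [← gramNorm_conjTranspose hr (block M i j)]
  rfl

/-- Columns are split off first; since the adjoint has the same `gramNorm`, each block column can
then be split in the same way. -/
theorem gramNorm_le_sum_block {m n : Type*} [Fintype m] [DecidableEq m] [Fintype n]
    [DecidableEq n] {r : ℝ} (hr : 1 ≤ r) (M : Matrix (m × n) (m × n) ℂ) :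
    gramNorm r M ≤ ∑ j, ∑ i, gramNorm r (block M i j) := by
  have hr0 : r ≠ 0 := by linarith
  refine (gramNorm_le_sum_blockColumns hr M).trans (sum_le_sum fun j _ => ?_)
  rw [← gramNorm_conjTranspose hr0]
  refine (gramNorm_le_sum_blockColumns hr _).trans_eq (sum_congr rfl fun i _ => ?_)
  exact gramNorm_block_eq hr0 M i j

theorem sum_block_le_gramNorm {m n : Type*} [Fintype m] [DecidableEq m] [Fintype n]
    [DecidableEq n] {r : ℝ} (hr0 : 0 < r) (hr : r ≤ 1) (M : Matrix (m × n) (m × n) ℂ) :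
    ∑ j, ∑ i, gramNorm r (block M i j) ≤ gramNorm r M := by
  refine le_trans (sum_le_sum fun j _ => ?_) (sum_blockColumns_le_gramNorm hr0 hr M)
  rw [← gramNorm_conjTranspose hr0.ne']
  refine le_trans (sum_congr rfl fun i _ => ?_).le (sum_blockColumns_le_gramNorm hr0 hr _)
  exact (gramNorm_block_eq hr0.ne' M i j).symm

/-! ### Unitary invariance, homogeneity and block bounds for Schatten norms -/

theorem gramNorm_isometry_mul {m n : Type*} [Fintype m] [DecidableEq m] [Fintype n] {r : ℝ}
    (hr : r ≠ 0) {V : Matrix m m ℂ} (hV : Vᴴ * V = 1) (M : Matrix m n ℂ) :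
    gramNorm r (V * M) = gramNorm r M := by
  rw [gramNorm, conjTranspose_mul, Matrix.mul_assoc, eigenPowerSum_mul_comm hr]
  simp only [Matrix.mul_assoc, hV, Matrix.mul_one, gramNorm]

theorem gramNorm_mul_unitary {m n : Type*} [Fintype m] [DecidableEq m] [Fintype n]
    [DecidableEq n] (r : ℝ) {V : Matrix n n ℂ} (hV : V * Vᴴ = 1) (M : Matrix m n ℂ) :
    gramNorm r (M * V) = gramNorm r M := by
  rw [gramNorm, conjTranspose_mul, Matrix.mul_assoc, ← Matrix.mul_assoc V, hV, Matrix.one_mul,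
    gramNorm]

theorem eigenPowerSum_smul {m : Type*} [Fintype m] [DecidableEq m] {r t : ℝ} (hr : 0 ≤ r)
    (ht : 0 ≤ t) {X : Matrix m m ℂ} (hX : X.PosSemidef) :
    eigenPowerSum r (t • X) = t ^ r * eigenPowerSum r X := by
  have hX' : (t • X).IsHermitian := by
    rw [Matrix.IsHermitian, conjTranspose_smul, hX.1.eq, star_trivial]
  have h := cfc_comp_smul t (fun x : ℝ => x ^ r) X
    (by exact (Real.continuous_rpow_const hr).continuousOn) hX.1
  rw [eigenPowerSum_eq_sum_eigenvalues r hX', ← trace_cfc_re hX' fun x => x ^ r, ← h,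
    trace_cfc_re hX.1, eigenPowerSum_eq_sum_eigenvalues r hX.1, mul_sum]
  refine sum_congr rfl fun i _ => ?_
  rw [smul_eq_mul, Real.mul_rpow ht (hX.eigenvalues_nonneg i)]

theorem gramNorm_smul {m n : Type*} [Fintype m] [DecidableEq m] [Fintype n] {r : ℝ} (hr : 0 < r)
    (c : ℂ) (M : Matrix m n ℂ) : gramNorm r (c • M) = ‖c‖ ^ 2 * gramNorm r M := by
  have h : (c • M) * (c • M)ᴴ = (‖c‖ ^ 2 : ℝ) • (M * Mᴴ) := by
    rw [conjTranspose_smul, Matrix.smul_mul, Matrix.mul_smul, smul_smul, ← Complex.coe_smul]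
    congr 1
    simp [Complex.mul_conj, Complex.normSq_eq_norm_sq]
  have hpos := posSemidef_self_mul_conjTranspose M
  rw [gramNorm, h, eigenPowerSum_smul hr.le (by positivity) hpos,
    Real.mul_rpow (by positivity) (eigenPowerSum_nonneg r hpos), ← Real.rpow_mul (by positivity),
    mul_one_div_cancel hr.ne', Real.rpow_one, gramNorm]

theorem schattenNorm_nonneg {m : Type*} [Fintype m] [DecidableEq m] {p : ℝ} (hp : 0 < p)
    (A : Matrix m m ℂ) : 0 ≤ schattenNorm p A := by
  rw [schattenNorm_eq hp]
  exact Real.rpow_nonneg (eigenPowerSum_nonneg _ (posSemidef_self_mul_conjTranspose A)) _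

/-- Passing to `r = p / 2` moves the threshold `p = 2` to `r = 1`, where powers change from concave
to convex. -/
theorem schattenNorm_sq {m : Type*} [Fintype m] [DecidableEq m] {p : ℝ} (hp : 0 < p)
    (A : Matrix m m ℂ) : schattenNorm p A ^ 2 = gramNorm (p / 2) A := by
  rw [schattenNorm_eq hp, gramNorm, ← Real.rpow_natCast, ← Real.rpow_mul
    (eigenPowerSum_nonneg _ (posSemidef_self_mul_conjTranspose A))]
  congr 1
  push_cast
  field_simp

theorem schattenNorm_smul {m : Type*} [Fintype m] [DecidableEq m] {p : ℝ} (hp : 0 < p) (c : ℂ)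
    (A : Matrix m m ℂ) : schattenNorm p (c • A) = ‖c‖ * schattenNorm p A := by
  have := schattenNorm_nonneg hp A
  rw [← sq_eq_sq₀ (schattenNorm_nonneg hp _) (by positivity), mul_pow, schattenNorm_sq hp,
    schattenNorm_sq hp, gramNorm_smul (by positivity)]

theorem schattenNorm_zero {m : Type*} [Fintype m] [DecidableEq m] {p : ℝ} (hp : 0 < p) :
    schattenNorm p (0 : Matrix m m ℂ) = 0 := by
  simpa using schattenNorm_smul hp 0 (0 : Matrix m m ℂ)

theorem schattenNorm_pos {m : Type*} [Fintype m] [DecidableEq m] {p : ℝ} (hp : 0 < p)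
    {A : Matrix m m ℂ} (hA : A ≠ 0) : 0 < schattenNorm p A := by
  have hpos := posSemidef_self_mul_conjTranspose A
  rw [schattenNorm_eq hp]
  refine Real.rpow_pos_of_pos ((eigenPowerSum_nonneg _ hpos).lt_of_ne' fun h => hA ?_) _
  rw [eigenPowerSum_eq_sum_eigenvalues _ hpos.1,
    sum_eq_zero_iff_of_nonneg fun i _ => Real.rpow_nonneg (hpos.eigenvalues_nonneg i) _] at h
  rw [← Matrix.self_mul_conjTranspose_eq_zero, ← hpos.1.eigenvalues_eq_zero_iff]
  ext i
  exact ((Real.rpow_eq_zero_iff_of_nonneg (hpos.eigenvalues_nonneg i)).1 (h i (mem_univ i))).1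

theorem schattenNorm_vecMulVec_star {m : Type*} [Fintype m] [DecidableEq m] {p : ℝ} (hp : 0 < p)
    {v : m → ℂ} (hv : star v ⬝ᵥ v = 1) : schattenNorm p (vecMulVec v (star v)) = 1 := by
  have h1 : vecMulVec v (star v) * (vecMulVec v (star v))ᴴ
      = replicateCol Unit v * replicateRow Unit (star v) := by
    rw [conjTranspose_vecMulVec, star_star, vecMulVec_mul_vecMulVec, hv, one_smul,
      vecMulVec_eq Unit]
  have h2 : replicateRow Unit (star v) * replicateCol Unit v = 1 := by
    ext i j
    simpa [Matrix.mul_apply, dotProduct] using hv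
  rw [schattenNorm_eq hp, h1, eigenPowerSum_mul_comm (by positivity), h2]
  simp only [eigenPowerSum, charpoly_one, Fintype.card_unit, pow_one]
  rw [← Polynomial.C_1, Polynomial.roots_X_sub_C]
  simp

theorem schattenNorm_unitary_conj {m : Type*} [Fintype m] [DecidableEq m] {p : ℝ} (hp : 0 < p)
    {V : Matrix m m ℂ} (hV : Vᴴ * V = 1) (M : Matrix m m ℂ) :
    schattenNorm p (Vᴴ * M * V) = schattenNorm p M := by
  have hV' : V * Vᴴ = 1 := mul_eq_one_comm.1 hV
  rw [← sq_eq_sq₀ (schattenNorm_nonneg hp _) (schattenNorm_nonneg hp _), schattenNorm_sq hp,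
    schattenNorm_sq hp, gramNorm_mul_unitary _ hV', gramNorm_isometry_mul (by positivity)]
  rwa [conjTranspose_conjTranspose]

theorem schattenNorm_sq_le_sum_block {m n : Type*} [Fintype m] [DecidableEq m] [Fintype n]
    [DecidableEq n] {p : ℝ} (hp : 2 ≤ p) (M : Matrix (m × n) (m × n) ℂ) :
    schattenNorm p M ^ 2 ≤ ∑ j, ∑ i, schattenNorm p (block M i j) ^ 2 := by
  simp only [schattenNorm_sq (show 0 < p by linarith)]
  exact gramNorm_le_sum_block (by linarith) M

theorem sum_block_le_schattenNorm_sq {m n : Type*} [Fintype m] [DecidableEq m] [Fintype n]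
    [DecidableEq n] {q : ℝ} (hq0 : 0 < q) (hq : q ≤ 2) (M : Matrix (m × n) (m × n) ℂ) :
    ∑ j, ∑ i, schattenNorm q (block M i j) ^ 2 ≤ schattenNorm q M ^ 2 := by
  simp only [schattenNorm_sq hq0]
  exact sum_block_le_gramNorm (by linarith) (by linarith) M

/-! ### Hadamard maps in the basis `b` -/

/-- The unitary matrix whose columns are the vectors of an orthonormal basis. -/
noncomputable def basisMatrix {m : Type*} [Fintype m]
    (b : OrthonormalBasis m ℂ (EuclideanSpace ℂ m)) : Matrix m m ℂ :=
  Matrix.of fun k i => b i k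

section Hadamard

variable {m n : Type*} [Fintype m] [DecidableEq m] [Fintype n] [DecidableEq n]
  (b : OrthonormalBasis m ℂ (EuclideanSpace ℂ m)) (C : Matrix m m ℂ)

theorem star_dotProduct_basis (i j : m) :
    star (b i : m → ℂ) ⬝ᵥ (b j : m → ℂ) = if i = j then 1 else 0 := by
  rw [← orthonormal_iff_ite.1 b.orthonormal i j, EuclideanSpace.inner_eq_star_dotProduct,
    dotProduct_comm]

theorem basisMatrix_conjTranspose_mul_self : (basisMatrix b)ᴴ * basisMatrix b = 1 := by
  ext i j
  rw [one_apply, ← star_dotProduct_basis b i j]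
  rfl

omit [DecidableEq m] in
theorem entry_eq (A : Matrix m m ℂ) (i j : m) :
    entry b A i j = ((basisMatrix b)ᴴ * A * basisMatrix b) i j := by
  rw [Matrix.mul_assoc]
  rfl

theorem entry_vecMulVec (i j k l : m) :
    entry b (vecMulVec (b k : m → ℂ) (star (b l : m → ℂ))) i j
      = if i = k ∧ l = j then 1 else 0 := by
  rw [entry, vecMulVec_mulVec, star_dotProduct_basis]
  by_cases h : l = j <;> simp [h, star_dotProduct_basis]

theorem entry_hadamardMap (A : Matrix m m ℂ) (i j : m) :
    entry b (hadamardMap b C A) i j = entry b C i j * entry b A i j := by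
  have hlin : ∀ (s : Finset m) (f : m → Matrix m m ℂ),
      entry b (∑ k ∈ s, f k) i j = ∑ k ∈ s, entry b (f k) i j := fun s f => by
    simp only [entry_eq, Finset.mul_sum, Finset.sum_mul, Matrix.sum_apply]
  have hsmul : ∀ (c : ℂ) (X : Matrix m m ℂ), entry b (c • X) i j = c * entry b X i j :=
    fun c X => by simp [entry_eq]
  change entry b (∑ k, ∑ l, (entry b C k l * entry b A k l) •
    vecMulVec (b k : m → ℂ) (star (b l : m → ℂ))) i j = _
  simp only [hlin, hsmul, entry_vecMulVec]
  simp [ite_and]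

theorem hadamardMap_vecMulVec_self (i : m) :
    hadamardMap b C (vecMulVec (b i : m → ℂ) (star (b i : m → ℂ)))
      = entry b C i i • vecMulVec (b i : m → ℂ) (star (b i : m → ℂ)) := by
  change ∑ k, ∑ l, (entry b C k l * entry b (vecMulVec (b i : m → ℂ) (star (b i : m → ℂ))) k l) •
    vecMulVec (b k : m → ℂ) (star (b l : m → ℂ)) = _
  simp only [entry_vecMulVec]
  simp [ite_and]

omit [Fintype n] [DecidableEq n] in
theorem eq_sum_single_kronecker_block (A : Matrix (m × n) (m × n) ℂ) :
    A = ∑ s, ∑ t, Matrix.single s t (1 : ℂ) ⊗ₖ block A s t := by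
  ext ⟨i, k⟩ ⟨j, l⟩
  simp [Matrix.sum_apply, Matrix.single_apply, block, ite_and]

omit [DecidableEq m] in
theorem block_conj_sum_kronecker (P : m → m → Matrix m m ℂ) (Q : m → m → Matrix n n ℂ) (i j : m) :
    block ((basisMatrix b ⊗ₖ (1 : Matrix n n ℂ))ᴴ * (∑ s, ∑ t, P s t ⊗ₖ Q s t)
        * (basisMatrix b ⊗ₖ (1 : Matrix n n ℂ))) i j
      = ∑ s, ∑ t, entry b (P s t) i j • Q s t := by
  have h : ∀ s t, (basisMatrix b ⊗ₖ (1 : Matrix n n ℂ))ᴴ * (P s t ⊗ₖ Q s t)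
      * (basisMatrix b ⊗ₖ (1 : Matrix n n ℂ))
      = ((basisMatrix b)ᴴ * P s t * basisMatrix b) ⊗ₖ Q s t := fun s t => by
    rw [conjTranspose_kronecker, ← mul_kronecker_mul, ← mul_kronecker_mul]
    simp
  simp only [Finset.mul_sum, Finset.sum_mul, h]
  ext k l
  simp [block, Matrix.sum_apply, entry_eq]

/-- In the basis `b`, the map `H_C ⊗ Ω` acts blockwise as `A_{ij} ↦ c_{ij} Ω(A_{ij})`. -/
theorem block_tensorMap_hadamardMap (Ω : Matrix n n ℂ →ₗ[ℂ] Matrix n n ℂ)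
    (A : Matrix (m × n) (m × n) ℂ) (i j : m) :
    block ((basisMatrix b ⊗ₖ (1 : Matrix n n ℂ))ᴴ * tensorMap (hadamardMap b C) Ω A
        * (basisMatrix b ⊗ₖ (1 : Matrix n n ℂ))) i j
      = entry b C i j • Ω (block ((basisMatrix b ⊗ₖ (1 : Matrix n n ℂ))ᴴ * A
        * (basisMatrix b ⊗ₖ (1 : Matrix n n ℂ))) i j) := by
  change block (_ * (∑ s, ∑ t, hadamardMap b C (Matrix.single s t 1) ⊗ₖ Ω (block A s t)) * _) i j
    = _
  conv_rhs => rw [eq_sum_single_kronecker_block A]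
  rw [block_conj_sum_kronecker, block_conj_sum_kronecker]
  simp only [entry_hadamardMap, map_sum, map_smul, smul_sum, smul_smul]

theorem basisMatrix_kronecker_one_isometry :
    (basisMatrix b ⊗ₖ (1 : Matrix n n ℂ))ᴴ * (basisMatrix b ⊗ₖ (1 : Matrix n n ℂ)) = 1 := by
  rw [conjTranspose_kronecker, ← mul_kronecker_mul, basisMatrix_conjTranspose_mul_self]
  simp

variable {C}

omit [DecidableEq m] in
theorem entry_posSemidef (hC : C.PosSemidef) :
    (Matrix.of fun i j => entry b C i j : Matrix m m ℂ).PosSemidef := by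
  have h : (Matrix.of fun i j => entry b C i j : Matrix m m ℂ)
      = (basisMatrix b)ᴴ * C * basisMatrix b := by
    ext i j
    exact entry_eq b C i j
  rw [h]
  exact hC.conjTranspose_mul_mul_same _

end Hadamard

/-- The off-diagonal entries of a positive semidefinite matrix are dominated by the diagonal. -/
theorem norm_apply_le_of_posSemidef {m : Type*} [Fintype m] [DecidableEq m] {C : Matrix m m ℂ}
    (hC : C.PosSemidef) {g : ℝ} (hg : ∀ i, ‖C i i‖ ≤ g) (i j : m) : ‖C i j‖ ≤ g := by
  have hdiag : ∀ k, (C k k).re ≤ g := fun k => (Complex.re_le_norm _).trans (hg k)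
  -- The phase `c` rotates `C i j` onto the nonnegative real axis.
  obtain ⟨c, hc, hcn⟩ : ∃ c : ℂ, ‖c‖ = 1 ∧ c * C i j = ‖C i j‖ := by
    by_cases h : C i j = 0
    · exact ⟨1, by simp [h]⟩
    · have h' : (‖C i j‖ : ℂ) ≠ 0 := by simpa using h
      refine ⟨‖C i j‖ / C i j, by simp [h], by field_simp⟩
  have hji : C j i = star (C i j) := (hC.1.apply j i).symm
  have hcc : star c * c = 1 := by
    rw [RCLike.star_def, ← Complex.normSq_eq_conj_mul_self, Complex.normSq_eq_norm_sq, hc]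
    simp
  have hcn' : star c * star (C i j) = ‖C i j‖ := by
    rw [← star_mul', hcn]
    simp
  -- On this vector the quadratic form equals `C i i + C j j - 2 ‖C i j‖`.
  have h := hC.dotProduct_mulVec_nonneg (Pi.single i (star c) - Pi.single j 1)
  simp only [star_sub, Pi.star_single, star_star, star_one, mulVec_sub, mulVec_single, sub_dotProduct,
    dotProduct_sub, single_dotProduct] at h
  simp only [Pi.smul_apply, col_apply, MulOpposite.smul_eq_mul_unop, MulOpposite.unop_op, one_mul,
    mul_one] at h
  have hval : c * (C i i * star c) - C j i * star c - (c * C i j - C j j)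
      = C i i + C j j - ((2 * ‖C i j‖ : ℝ) : ℂ) := by
    rw [hji]
    push_cast
    linear_combination C i i * hcc - hcn' - hcn
  rw [hval] at h
  have h2 := (Complex.le_def.1 h).1
  simp only [Complex.zero_re, Complex.sub_re, Complex.add_re, Complex.ofReal_re] at h2
  linarith [hdiag i, hdiag j]

/-! ### Bounds on the output purity -/

section Bounds

variable {m n : Type*} [Fintype m] [DecidableEq m] [Fintype n] [DecidableEq n]

theorem schattenNorm_tensorMap_hadamardMap_le (b : OrthonormalBasis m ℂ (EuclideanSpace ℂ m))
    {C : Matrix m m ℂ} (Ω : Matrix n n ℂ →ₗ[ℂ] Matrix n n ℂ) {q p g w : ℝ} (hq1 : 0 < q)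
    (hq2 : q ≤ 2) (hp : 2 ≤ p) (hg0 : 0 ≤ g) (hg : ∀ i j, ‖entry b C i j‖ ≤ g) (hw0 : 0 ≤ w)
    (hw : ∀ B, schattenNorm p (Ω B) ≤ w * schattenNorm q B) (A : Matrix (m × n) (m × n) ℂ) :
    schattenNorm p (tensorMap (hadamardMap b C) Ω A) ≤ g * w * schattenNorm q A := by
  have hp0 : 0 < p := by linarith
  have hV := basisMatrix_kronecker_one_isometry (n := n) b
  have hA0 := schattenNorm_nonneg hq1 A
  refine le_of_sq_le_sq ?_ (by positivity)
  -- Conjugation by the unitary `basisMatrix b ⊗ 1` preserves both norms and makes the blocks those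
  -- of the basis `b`.
  rw [← schattenNorm_unitary_conj hp0 hV, ← schattenNorm_unitary_conj hq1 hV A, mul_pow]
  refine (schattenNorm_sq_le_sum_block hp _).trans
    (le_trans ?_ (mul_le_mul_of_nonneg_left (sum_block_le_schattenNorm_sq hq1 hq2 _)
      (sq_nonneg (g * w))))
  rw [mul_sum]
  refine sum_le_sum fun j _ => ?_
  rw [mul_sum]
  refine sum_le_sum fun i _ => ?_
  rw [block_tensorMap_hadamardMap, schattenNorm_smul hp0, ← mul_pow, mul_assoc g w]
  refine pow_le_pow_left₀ (mul_nonneg (norm_nonneg _) (schattenNorm_nonneg hp0 _)) ?_ 2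
  exact mul_le_mul (hg i j) (hw _) (schattenNorm_nonneg hp0 _) hg0

theorem schattenNorm_le_outputPurity_mul {q p : ℝ} (hq : 0 < q) (hp : 0 < p)
    {L : Matrix m m ℂ →ₗ[ℂ] Matrix n n ℂ} (hL : outputPurity q p L ≠ ⊤) (B : Matrix m m ℂ) :
    schattenNorm p (L B) ≤ (outputPurity q p L).toReal * schattenNorm q B := by
  by_cases hB : B = 0
  · simp [hB, schattenNorm_zero hp, schattenNorm_zero hq]
  · rw [← div_le_iff₀ (schattenNorm_pos hq hB), ← ENNReal.ofReal_le_iff_le_toReal hL]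
    exact le_iSup₂_of_le B hB le_rfl

theorem norm_entry_le_outputPurity (b : OrthonormalBasis m ℂ (EuclideanSpace ℂ m))
    (C : Matrix m m ℂ) {q p : ℝ} (hq : 0 < q) (hp : 0 < p) (i : m) :
    ENNReal.ofReal ‖entry b C i i‖ ≤ outputPurity q p (hadamardMap b C) := by
  have hv : star (b i : m → ℂ) ⬝ᵥ (b i : m → ℂ) = 1 := by simp [star_dotProduct_basis]
  have h0 : vecMulVec (b i : m → ℂ) (star (b i : m → ℂ)) ≠ 0 := fun h => by
    simpa [h, schattenNorm_zero hp] using schattenNorm_vecMulVec_star hp hv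
  refine le_iSup₂_of_le _ h0 ?_
  rw [hadamardMap_vecMulVec_self, schattenNorm_smul hp, schattenNorm_vecMulVec_star hp hv,
    schattenNorm_vecMulVec_star hq hv, mul_one, div_one]

theorem outputPurity_tensorMap_hadamardMap_le [Nonempty m]
    (b : OrthonormalBasis m ℂ (EuclideanSpace ℂ m))
    {C : Matrix m m ℂ} (hC : C.PosSemidef) {q p : ℝ} (hq1 : 0 < q) (hq2 : q ≤ 2) (hp : 2 ≤ p)
    {Ω : Matrix n n ℂ →ₗ[ℂ] Matrix n n ℂ} (hΩ : outputPurity q p Ω ≠ ⊤) :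
    outputPurity q p (tensorMap (hadamardMap b C) Ω)
      ≤ outputPurity q p (hadamardMap b C) * outputPurity q p Ω := by
  have hp0 : 0 < p := by linarith
  -- The largest diagonal entry bounds every entry of `C` and is itself bounded by the purity of
  -- `H_C`.
  obtain ⟨i₀, hi₀⟩ := Finite.exists_max fun i => ‖entry b C i i‖
  have hg := norm_apply_le_of_posSemidef (entry_posSemidef b hC) hi₀
  refine iSup₂_le fun A hA => ?_
  have h := schattenNorm_tensorMap_hadamardMap_le b Ω hq1 hq2 hp (norm_nonneg _) hg
    ENNReal.toReal_nonneg (schattenNorm_le_outputPurity_mul hq1 hp0 hΩ) A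
  rw [← div_le_iff₀ (schattenNorm_pos hq1 hA)] at h
  refine (ENNReal.ofReal_le_ofReal h).trans ?_
  rw [ENNReal.ofReal_mul (norm_nonneg _), ENNReal.ofReal_toReal hΩ]
  gcongr
  exact norm_entry_le_outputPurity b C hq1 hp0 i₀

theorem schattenNorm_kronecker_one [Unique n] {p : ℝ} (hp : 0 < p) (A : Matrix m m ℂ) :
    schattenNorm p (A ⊗ₖ (1 : Matrix n n ℂ)) = schattenNorm p A := by
  have h : (A ⊗ₖ (1 : Matrix n n ℂ)) * (A ⊗ₖ (1 : Matrix n n ℂ))ᴴ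
      = reindex (Equiv.prodUnique m n).symm (Equiv.prodUnique m n).symm (A * Aᴴ) := by
    rw [conjTranspose_kronecker, ← mul_kronecker_mul]
    ext ⟨i, k⟩ ⟨j, l⟩
    simp [Subsingleton.elim k l]
  rw [schattenNorm_eq hp, schattenNorm_eq hp, h, eigenPowerSum, charpoly_reindex, eigenPowerSum]

theorem outputPurity_le_outputPurity_tensorMap_id [Unique n] {q p : ℝ} (hq : 0 < q) (hp : 0 < p)
    (L : Matrix m m ℂ →ₗ[ℂ] Matrix m m ℂ) :
    outputPurity q p L
      ≤ outputPurity q p (tensorMap L (LinearMap.id : Matrix n n ℂ →ₗ[ℂ] Matrix n n ℂ)) := by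
  refine iSup₂_le fun A hA => ?_
  have h0 : A ⊗ₖ (1 : Matrix n n ℂ) ≠ 0 := fun h => by
    have h1 := schattenNorm_kronecker_one (n := n) hp A
    rw [h, schattenNorm_zero hp] at h1
    exact (schattenNorm_pos hp hA).ne h1
  refine le_iSup₂_of_le _ h0 ?_
  rw [tensorMap_kronecker, LinearMap.id_apply, schattenNorm_kronecker_one hp,
    schattenNorm_kronecker_one hq]

theorem outputPurity_id_of_unique [Unique n] {q p : ℝ} (hq : 0 < q) (hp : 0 < p) :
    outputPurity q p (LinearMap.id : Matrix n n ℂ →ₗ[ℂ] Matrix n n ℂ) = 1 := by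
  have hv : star (1 : n → ℂ) ⬝ᵥ (1 : n → ℂ) = 1 := by simp
  have h1 : vecMulVec (1 : n → ℂ) (star (1 : n → ℂ)) = 1 := by
    ext i j
    rw [Subsingleton.elim i j, one_apply_eq]
    simp [vecMulVec_apply]
  have hone : ∀ s : ℝ, 0 < s → schattenNorm s (1 : Matrix n n ℂ) = 1 := fun s hs => by
    rw [← h1, schattenNorm_vecMulVec_star hs hv]
  have hA : ∀ A : Matrix n n ℂ, A = A default default • (1 : Matrix n n ℂ) := fun A => by
    ext i j
    simp [Subsingleton.elim i default, Subsingleton.elim j default]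
  have hval : ∀ A : Matrix n n ℂ, ∀ s : ℝ, 0 < s → schattenNorm s A = ‖A default default‖ :=
    fun A s hs => by
      conv_lhs => rw [hA A]
      rw [schattenNorm_smul hs, hone s hs, mul_one]
  refine le_antisymm (iSup₂_le fun A hA0 => ?_) (le_iSup₂_of_le 1 one_ne_zero ?_)
  · rw [LinearMap.id_apply, hval A p hp, hval A q hq]
    exact ENNReal.ofReal_le_one.2 (div_self_le_one _)
  · simp [hone p hp, hone q hq]

omit [DecidableEq n] in
theorem isCompletelyPositive_id :
    IsCompletelyPositive (LinearMap.id : Matrix n n ℂ →ₗ[ℂ] Matrix n n ℂ) := fun k _ A hA => by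
  have h : tensorMap (LinearMap.id : Matrix (Fin k) (Fin k) ℂ →ₗ[ℂ] _)
      (LinearMap.id : Matrix n n ℂ →ₗ[ℂ] _) A = A := (eq_sum_single_kronecker_block A).symm
  rwa [h]

end Bounds

end OutputPurity

theorem theorem4 (d : ℕ) (b : OrthonormalBasis (Fin d) ℂ (EuclideanSpace ℂ (Fin d)))
    (C : Matrix (Fin d) (Fin d) ℂ) (hC : C.PosSemidef)
    (q p : ℝ) (hq1 : 1 ≤ q) (hq2 : q ≤ 2) (hp : 2 ≤ p) :
    OutputPurity.potentialPurity q p (OutputPurity.hadamardMap b C) =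
      OutputPurity.outputPurity q p (OutputPurity.hadamardMap b C) := by
  have hq0 : 0 < q := by linarith
  have hp0 : 0 < p := by linarith
  refine le_antisymm ?_ ?_
  · refine iSup₂_le fun k _ => iSup₂_le fun Ω _ => iSup_le fun _ => ?_
    -- In `ℝ≥0∞` division by `⊤` gives `0`, so an infinite denominator is harmless.
    by_cases hΩ : OutputPurity.outputPurity q p Ω = ⊤
    · simp [hΩ]
    refine ENNReal.div_le_of_le_mul ?_
    -- For `d = 0` there is no diagonal entry to maximise, but also no nonzero matrix, so the
    -- supremum is `0`.
    rcases isEmpty_or_nonempty (Fin d) with hd | hd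
    · exact iSup₂_le fun A hA => absurd (Subsingleton.elim A 0) hA
    · exact OutputPurity.outputPurity_tensorMap_hadamardMap_le b hC hq0 hq2 hp hΩ
  · refine (OutputPurity.outputPurity_le_outputPurity_tensorMap_id (n := Fin 1) hq0 hp0 _).trans ?_
    refine le_iSup₂_of_le 1 le_rfl (le_iSup₂_of_le LinearMap.id
      OutputPurity.isCompletelyPositive_id (le_iSup_of_le ?_ ?_))
    · intro h
      exact one_ne_zero (LinearMap.congr_fun h (1 : Matrix (Fin 1) (Fin 1) ℂ))
    · rw [OutputPurity.outputPurity_id_of_unique hq0 hp0, div_one]
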